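/- Let $n\in\mathbb{N}$ and let $A,B$ be positive semidefinite complex $n\times n$ matrices with $B$ positive definite. For $\alpha,z>0$ with $\alpha\neq1$ put $$P_\alpha(A,B):=B^{1/2}\bigl(B^{-1/2}AB^{-1/2}\bigr)^{\alpha}B^{1/2},\qquad Q_{\alpha,z}(A,B):=\Bigl(B^{\frac{1-\alpha}{2z}}A^{\frac{\alpha}{z}}B^{\frac{1-\alpha}{2z}}\Bigr)^{z},$$ $$Q_\alpha(A,B):=Q_{\alpha,1}(A,B)=B^{\frac{1-\alpha}{2}}A^{\alpha}B^{\frac{1-\alpha}{2}}.$$ For positive semidefinite $n\times n$ matrices $X,Y$, the log-majorization $X\prec_{\log}Y$ means that $\prod_{i=1}^k\lambda_i(X)\le\prod_{i=1}^k\lambda_i(Y)$ for $k=1,\dots,n$, with equality for $k=n$, where $\lambda_1(\cdot)\ge\dots\ge\lambda_n(\cdot)$ are the eigenvalues in decreasing order counted with multiplicity. Then: (1) if $0<\alpha<1$ and $z>0$, then $P_\alpha(A,B)\prec_{\log}Q_{\alpha,z}(A,B)$; (2) if $\alpha>1$ and $0<z\le\min\{\alpha/2,\alpha-1\}$, then $P_\alpha(A,B)\prec_{\log}Q_{\alpha,z}(A,B)$;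 (3) if $\alpha>1$ and $z\ge\max\{\alpha/2,\alpha-1\}$, then $Q_{\alpha,z}(A,B)\prec_{\log}P_\alpha(A,B)$. In particular, $P_\alpha(A,B)\prec_{\log}Q_\alpha(A,B)$ if $0<\alpha<1$ or $\alpha\ge2$, and $Q_\alpha(A,B)\prec_{\log}P_\alpha(A,B)$ if $1<\alpha\le2$. -/

import Mathlib

namespace Renyi

open scoped ComplexOrder MatrixOrder

variable {ι : Type*} [Fintype ι] [DecidableEq ι]

/-- `P_α(A,B) = B^{1/2} (B^{-1/2} A B^{-1/2})^α B^{1/2}`. Real powers of matrices are those of the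
continuous functional calculus (so `0 ^ r = 0` on a kernel for `r > 0`). -/
noncomputable def P (α : ℝ) (A B : Matrix ι ι ℂ) : Matrix ι ι ℂ :=
  B ^ (1 / 2 : ℝ) * (B ^ (-(1 / 2) : ℝ) * A * B ^ (-(1 / 2) : ℝ)) ^ α * B ^ (1 / 2 : ℝ)

/-- `Q_{α,z}(A,B) = (B^{(1-α)/(2z)} A^{α/z} B^{(1-α)/(2z)})^z`. -/
noncomputable def Q (α z : ℝ) (A B : Matrix ι ι ℂ) : Matrix ι ι ℂ :=
  (B ^ ((1 - α) / (2 * z)) * A ^ (α / z) * B ^ ((1 - α) / (2 * z))) ^ z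

/-- `Q_α(A,B) = Q_{α,1}(A,B)`. -/
noncomputable def Q₁ (α : ℝ) (A B : Matrix ι ι ℂ) : Matrix ι ι ℂ :=
  Q α 1 A B

/-- `Q_α(A,B) = B^{(1-α)/2} A^α B^{(1-α)/2}`. -/
theorem Q₁_eq (α : ℝ) (A B : Matrix ι ι ℂ) :
    Q₁ α A B = B ^ ((1 - α) / 2) * A ^ α * B ^ ((1 - α) / 2) := by
  have hB : IsSelfAdjoint (B ^ ((1 - α) / 2)) :=
    IsSelfAdjoint.of_nonneg CFC.rpow_nonneg
  have h : 0 ≤ B ^ ((1 - α) / 2) * A ^ α * B ^ ((1 - α) / 2) :=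
    hB.conjugate_nonneg CFC.rpow_nonneg
  simp only [Q₁, Q, mul_one, div_one]
  exact CFC.rpow_one _ h

/-- Log-majorization `X ≺_log Y` of positive semidefinite matrices. `eigenvalues₀` lists the
eigenvalues in decreasing order, with multiplicity, indexed from `0`. -/
def LogMajorizedBy (X Y : Matrix ι ι ℂ) : Prop :=
  ∃ (hX : X.PosSemidef) (hY : Y.PosSemidef),
    (∀ k : ℕ, 1 ≤ k → k ≤ Fintype.card ι →
      ∏ i : Fin (Fintype.card ι) with i.val < k, hX.isHermitian.eigenvalues₀ i ≤
        ∏ i : Fin (Fintype.card ι) with i.val < k, hY.isHermitian.eigenvalues₀ i) ∧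
    ∏ i, hX.isHermitian.eigenvalues₀ i = ∏ i, hY.isHermitian.eigenvalues₀ i

end Renyi

open scoped ComplexOrder

/-! The product of the `k` largest eigenvalues of a positive semidefinite matrix is the operator
norm of its `k`-th compound (exterior power). Compounds are multiplicative and commute with real
powers of positive semidefinite matrices, so they carry `P` and `Q` to the same expressions in the
compounds of `A` and `B`. Log-majorization thus reduces to equality of determinants and a single
norm inequality, proved in any C⋆-algebra.

Both sides are homogeneous of degree `α` in `a`, so scaling reduces the norm inequality to an
implication between `Q ≤ 1` and `P ≤ 1`; singular `a` is reached by continuity. With `k = b^(-1/2) a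
b^(-1/2)`, these conditions read `a^(α/z) ≤ b^((α-1)/z)` and `k^α ≤ b^(-1)`. For `α < 1` the
implication is a Furuta inequality (`furuta_div`). For `1 < α ≤ 2`, and for the reverse direction,
Löwner–Heinz suffices after `conjugate_rpow` brings an outer exponent into operator monotone range.
For `α ≥ 2` the exponent is too large for this, and `mul_rpow_mul_le` interpolates a quadratic
inequality so that powers can be raised two at a time. -/

section CStar

variable {𝒜 : Type*} [CStarAlgebra 𝒜] [PartialOrder 𝒜] [StarOrderedRing 𝒜]

/-! ### Operator inequalities for real powers: Furuta, Hansen, interpolation. -/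

namespace CFC

/-- `a ↦ a ^ p` is operator antitone for `p ∈ [-1, 0]`. -/
theorem rpow_le_rpow_of_nonpos {a b : 𝒜} {p : ℝ} (hp : p ∈ Set.Icc (-1 : ℝ) 0) (hab : a ≤ b)
    (ha : IsStrictlyPositive a) : b ^ p ≤ a ^ p := by
  have hb : IsStrictlyPositive b := ha.of_le hab
  have h := CFC.rpow_le_rpow (p := -p) ⟨by linarith [hp.2], by linarith [hp.1]⟩
    (CStarAlgebra.rpow_neg_one_le_rpow_neg_one hab ha)
  rwa [CFC.rpow_rpow a _ _ (by norm_num) ha, CFC.rpow_rpow b _ _ (by norm_num) hb,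
    show (-1 : ℝ) * -p = p by ring] at h

theorem star_rpow (a : 𝒜) (r : ℝ) : star (a ^ r) = a ^ r :=
  (IsSelfAdjoint.of_nonneg CFC.rpow_nonneg).star_eq

theorem rpow_rpow' {a : 𝒜} (ha : IsStrictlyPositive a) (x y : ℝ) :
    (a ^ x) ^ y = a ^ (x * y) := by
  rcases eq_or_ne x 0 with rfl | hx
  · simp [CFC.rpow_zero a ha.nonneg]
  · exact CFC.rpow_rpow a x y hx ha

theorem rpow_mul_rpow {a : 𝒜} (ha : IsStrictlyPositive a) (x y : ℝ) :
    a ^ x * a ^ y = a ^ (x + y) := (CFC.rpow_add ha.isUnit).symm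

theorem rpow_mul_rpow_mul_rpow {a : 𝒜} (ha : IsStrictlyPositive a) (x y z : ℝ) :
    a ^ x * a ^ y * a ^ z = a ^ (x + y + z) := by
  rw [rpow_mul_rpow ha, rpow_mul_rpow ha]

/-- Conjugation by `c ^ r` preserves the order. -/
theorem rpow_conjugate_le {a b : 𝒜} (hab : a ≤ b) (c : 𝒜) (r : ℝ) :
    c ^ r * a * c ^ r ≤ c ^ r * b * c ^ r :=
  conjugate_le_conjugate_of_nonneg hab CFC.rpow_nonneg

/-- The functional calculus commutes with unitary conjugation. -/
theorem unitary_conj_rpow (u : unitary 𝒜) {a : 𝒜} (ha : IsStrictlyPositive a) (r : ℝ) :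
    ((u : 𝒜) * a * star (u : 𝒜)) ^ r = u * a ^ r * star (u : 𝒜) := by
  have hs : (0 : NNReal) ∉ spectrum NNReal a := spectrum.zero_notMem _ ha.isUnit
  have h := StarAlgHomClass.map_cfc (R := NNReal) (S := ℂ) (Unitary.conjStarAlgAut ℂ 𝒜 u)
    (fun x : NNReal => x ^ r) a
    (NNReal.continuousOn_rpow_const (.inl hs))
    (by change Continuous fun x : 𝒜 => (u : 𝒜) * x * star (u : 𝒜); fun_prop) ha.nonneg
    (by simpa using star_right_conjugate_nonneg ha.nonneg (u : 𝒜))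
  simpa [CFC.rpow_def] using h.symm

theorem isStrictlyPositive_mul_star {x : 𝒜} (hx : IsUnit x) : IsStrictlyPositive (x * star x) :=
  ⟨mul_star_self_nonneg x, hx.mul hx.star⟩

/-- `(x x⋆) ^ r = x (x⋆ x) ^ (r - 1) x⋆` for invertible `x`. -/
theorem mul_star_rpow {x : 𝒜} (hx : IsUnit x) (r : ℝ) :
    (x * star x) ^ r = x * (star x * x) ^ (r - 1) * star x := by
  set a := star x * x with ha_def
  have ha : IsStrictlyPositive a := by
    simpa using isStrictlyPositive_mul_star hx.star
  have hp : a ^ (-(1 / 2) : ℝ) * a * a ^ (-(1 / 2) : ℝ) = 1 := by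
    nth_rewrite 2 [← CFC.rpow_one a ha.nonneg]
    rw [rpow_mul_rpow_mul_rpow ha]
    norm_num [CFC.rpow_zero a ha.nonneg]
  have hu1 : star (x * a ^ (-(1 / 2) : ℝ)) * (x * a ^ (-(1 / 2) : ℝ)) = 1 := by
    rw [star_mul, star_rpow, ← hp, ha_def]
    simp only [mul_assoc]
  -- Polar decomposition: `u = x a^(-1/2)` is an invertible isometry, hence unitary, and `x x⋆ = u a
  -- u⋆`.
  have hun : IsUnit (x * a ^ (-(1 / 2) : ℝ)) := hx.mul (ha.isUnit.cfcRpow _ ha.nonneg)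
  have hu2 : (x * a ^ (-(1 / 2) : ℝ)) * star (x * a ^ (-(1 / 2) : ℝ)) = 1 := by
    obtain ⟨w, hw⟩ := hun
    rw [← hw] at hu1 ⊢
    rw [← w.mul_inv, Units.inv_eq_of_mul_eq_one_left hu1]
  have h := unitary_conj_rpow ⟨_, Unitary.mem_iff.2 ⟨hu1, hu2⟩⟩ ha
  have e : ∀ s : ℝ, x * a ^ (-(1 / 2) : ℝ) * a ^ s * star (x * a ^ (-(1 / 2) : ℝ))
      = x * a ^ (s - 1) * star x := by
    intro s
    rw [star_mul, star_rpow]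
    calc _ = x * (a ^ (-(1 / 2) : ℝ) * a ^ s * a ^ (-(1 / 2) : ℝ)) * star x := by
          simp only [mul_assoc]
      _ = _ := by rw [rpow_mul_rpow_mul_rpow ha]; ring_nf
  have h1 := h r
  have e1 := e 1
  rw [CFC.rpow_one a ha.nonneg, sub_self, CFC.rpow_zero a ha.nonneg, mul_one] at e1
  simp only at h1
  rwa [e1, e r] at h1

theorem isStrictlyPositive_conjugate {a b : 𝒜} (ha : IsStrictlyPositive a)
    (hb : IsStrictlyPositive b) (r : ℝ) : IsStrictlyPositive (b ^ r * a * b ^ r) :=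
  ⟨(IsSelfAdjoint.of_nonneg CFC.rpow_nonneg).conjugate_nonneg ha.nonneg,
    ((hb.isUnit.cfcRpow r hb.nonneg).mul ha.isUnit).mul (hb.isUnit.cfcRpow r hb.nonneg)⟩

/-- `(b ^ t a ^ s b ^ t) ^ r = b ^ t a ^ (s / 2) (a ^ (s / 2) b ^ (2t) a ^ (s / 2)) ^ (r - 1)
a ^ (s / 2) b ^ t`. -/
theorem conjugate_rpow {a b : 𝒜} (ha : IsStrictlyPositive a)
    (hb : IsStrictlyPositive b) (s t r : ℝ) :
    (b ^ t * a ^ s * b ^ t) ^ r =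
      b ^ t * (a ^ (s / 2) * (a ^ (s / 2) * b ^ (2 * t) * a ^ (s / 2)) ^ (r - 1) * a ^ (s / 2)) *
        b ^ t := by
  have hx : IsUnit (b ^ t * a ^ (s / 2)) :=
    (hb.isUnit.cfcRpow t hb.nonneg).mul (ha.isUnit.cfcRpow _ ha.nonneg)
  have h := mul_star_rpow hx r
  rw [star_mul, star_rpow, star_rpow] at h
  have e1 : b ^ t * a ^ (s / 2) * (a ^ (s / 2) * b ^ t) = b ^ t * a ^ s * b ^ t := by
    rw [show b ^ t * a ^ (s / 2) * (a ^ (s / 2) * b ^ t) =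
      b ^ t * (a ^ (s / 2) * a ^ (s / 2)) * b ^ t by simp only [mul_assoc], rpow_mul_rpow ha]
    ring_nf
  have e2 : a ^ (s / 2) * b ^ t * (b ^ t * a ^ (s / 2)) =
      a ^ (s / 2) * b ^ (2 * t) * a ^ (s / 2) := by
    rw [show a ^ (s / 2) * b ^ t * (b ^ t * a ^ (s / 2)) =
      a ^ (s / 2) * (b ^ t * b ^ t) * a ^ (s / 2) by simp only [mul_assoc], rpow_mul_rpow hb]
    ring_nf
  rw [e1, e2] at h
  rw [h]
  simp only [mul_assoc]

/-- The Furuta inequality for small `r`. -/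
theorem furuta_of_le_one {a b : 𝒜} (ha : IsStrictlyPositive a) (hab : a ≤ b) {r s : ℝ}
    (hr : 0 ≤ r) (hr1 : r ≤ 1) (hs : 1 ≤ s) :
    (b ^ (r / 2) * a ^ s * b ^ (r / 2)) ^ ((1 + r) / (s + r)) ≤ b ^ (1 + r) := by
  have hb : IsStrictlyPositive b := ha.of_le hab
  -- The exchange formula lowers the outer exponent by one, to a value in `[-1, 0]`, where powers
  -- are operator antitone; a lower bound on the inner factor is then enough.
  rw [conjugate_rpow ha hb, show 2 * (r / 2) = r by ring]
  have h1 : a ^ (s + r) ≤ a ^ (s / 2) * b ^ r * a ^ (s / 2) := by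
    have := rpow_conjugate_le (CFC.rpow_le_rpow ⟨hr, hr1⟩ hab) a (s / 2)
    rwa [rpow_mul_rpow_mul_rpow ha, show s / 2 + r + s / 2 = s + r by ring] at this
  have hsr : 0 < s + r := by linarith
  have h2 := rpow_le_rpow_of_nonpos (p := (1 + r) / (s + r) - 1)
    ⟨by have : 0 ≤ (1 + r) / (s + r) := by positivity
        linarith, by rw [sub_nonpos, div_le_one hsr]; linarith⟩ h1 (ha.rpow a _)
  have h3 := rpow_conjugate_le h2 a (s / 2)
  rw [rpow_rpow' ha, rpow_mul_rpow_mul_rpow ha,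
    show s / 2 + (s + r) * ((1 + r) / (s + r) - 1) + s / 2 = 1 by field_simp; ring,
    CFC.rpow_one a ha.nonneg] at h3
  have h4 := rpow_conjugate_le (h3.trans hab) b (r / 2)
  refine h4.trans_eq ?_
  nth_rewrite 2 [← CFC.rpow_one b hb.nonneg]
  rw [rpow_mul_rpow_mul_rpow hb]
  ring_nf

/-- The Furuta inequality. -/
theorem furuta {a b : 𝒜} (ha : IsStrictlyPositive a) (hab : a ≤ b) {r s : ℝ}
    (hr : 0 ≤ r) (hs : 1 ≤ s) :
    (b ^ (r / 2) * a ^ s * b ^ (r / 2)) ^ ((1 + r) / (s + r)) ≤ b ^ (1 + r) := by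
  have hb : IsStrictlyPositive b := ha.of_le hab
  obtain ⟨n, hn⟩ := pow_unbounded_of_one_lt (1 + r) (one_lt_two : (1 : ℝ) < 2)
  induction n generalizing r with
  | zero => exact furuta_of_le_one ha hab hr (by norm_num at hn; linarith) hs
  | succ n ih =>
    rcases le_total r 1 with h1 | h1
    · exact furuta_of_le_one ha hab hr h1 hs
    -- Since `1 + q = (1 + r) / 2`, the induction hypothesis applies to `q`. The case `r = 1` is
    -- then applied to the resulting pair, with `s` replaced by `(s + q) / (1 + q)` to undo the
    -- outer power.
    obtain ⟨q, rfl⟩ : ∃ q, r = 2 * q + 1 := ⟨(r - 1) / 2, by ring⟩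
    have hq : 0 ≤ q := by linarith
    have hle := ih hq (by rw [pow_succ] at hn; linarith)
    have hsq : 0 < s + q := by linarith
    have hc : IsStrictlyPositive (b ^ (q / 2) * a ^ s * b ^ (q / 2)) :=
      isStrictlyPositive_conjugate (ha.rpow a s) hb _
    have h := furuta_of_le_one (hc.rpow _ ((1 + q) / (s + q))) hle zero_le_one le_rfl
      (s := (s + q) / (1 + q)) (by rw [le_div_iff₀ (by linarith)]; linarith)
    rw [rpow_rpow' hc, rpow_rpow' hb, rpow_rpow' hb,
      show (1 + q) / (s + q) * ((s + q) / (1 + q)) = 1 by field_simp,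
      CFC.rpow_one _ hc.nonneg] at h
    have e : b ^ ((1 + q) * (1 / 2)) * (b ^ (q / 2) * a ^ s * b ^ (q / 2)) *
        b ^ ((1 + q) * (1 / 2)) = b ^ ((2 * q + 1) / 2) * a ^ s * b ^ ((2 * q + 1) / 2) := by
      rw [show b ^ ((1 + q) * (1 / 2)) * (b ^ (q / 2) * a ^ s * b ^ (q / 2)) *
          b ^ ((1 + q) * (1 / 2)) = (b ^ ((1 + q) * (1 / 2)) * b ^ (q / 2)) * a ^ s *
            (b ^ (q / 2) * b ^ ((1 + q) * (1 / 2))) by simp only [mul_assoc],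
        rpow_mul_rpow hb, rpow_mul_rpow hb]
      ring_nf
    rw [e] at h
    convert h using 2
    · have : s + q + (1 + q) ≠ 0 := by positivity
      have : s + (2 * q + 1) ≠ 0 := by positivity
      field_simp
      ring
    · ring

/-- A consequence of the Furuta inequality with the smaller outer exponent `r / (s + r)`, valid for
all positive `r` and `s`. -/
theorem furuta_div {a b : 𝒜} (ha : IsStrictlyPositive a) (hab : a ≤ b) {r s : ℝ}
    (hr : 0 < r) (hs : 0 < s) :
    (b ^ (r / 2) * a ^ s * b ^ (r / 2)) ^ (r / (s + r)) ≤ b ^ r := by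
  have hb : IsStrictlyPositive b := ha.of_le hab
  rcases le_total 1 s with h1 | h1
  · have h := CFC.rpow_le_rpow (p := r / (1 + r))
      ⟨by positivity, by rw [div_le_one (by positivity)]; linarith⟩ (furuta ha hab hr.le h1)
    rw [rpow_rpow' (isStrictlyPositive_conjugate (ha.rpow a s) hb _), rpow_rpow' hb] at h
    convert h using 2 <;> field_simp
  · have h := rpow_conjugate_le (CFC.rpow_le_rpow ⟨hs.le, h1⟩ hab) b (r / 2)
    rw [rpow_mul_rpow_mul_rpow hb] at h
    have h2 := CFC.rpow_le_rpow (p := r / (s + r))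
      ⟨by positivity, by rw [div_le_one (by positivity)]; linarith⟩ h
    rw [rpow_rpow' hb] at h2
    convert h2 using 2
    field_simp
    ring

/-- Hansen's inequality for the power functions: if `t t⋆ ≤ 1` with `t` invertible and
`p ∈ [0, 1]`, then `t⋆ h ^ p t ≤ (t⋆ h t) ^ p`. -/
theorem hansen_rpow {t h : 𝒜} (ht : IsUnit t) (ht1 : t * star t ≤ 1) (hh : IsStrictlyPositive h)
    {p : ℝ} (hp : p ∈ Set.Icc (0 : ℝ) 1) :
    star t * h ^ p * t ≤ (star t * h * t) ^ p := by
  have hx : IsUnit (star t * h ^ (1 / 2 : ℝ)) := ht.star.mul (hh.isUnit.cfcRpow _ hh.nonneg)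
  have hone : h ^ (1 / 2 : ℝ) * h ^ (1 / 2 : ℝ) = h := by
    rw [rpow_mul_rpow hh, add_halves, CFC.rpow_one h hh.nonneg]
  have e := mul_star_rpow hx p
  rw [star_mul, star_rpow, star_star] at e
  have e1 : star t * h ^ (1 / 2 : ℝ) * (h ^ (1 / 2 : ℝ) * t) = star t * h * t := by
    rw [← mul_assoc, mul_assoc (star t), hone]
  have e2 : h ^ (1 / 2 : ℝ) * t * (star t * h ^ (1 / 2 : ℝ)) =
      h ^ (1 / 2 : ℝ) * (t * star t) * h ^ (1 / 2 : ℝ) := by simp only [mul_assoc]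
  rw [e1, e2] at e
  rw [e]
  -- After the exchange the outer exponent is `p - 1 ∈ [-1, 0]`, so the contraction bound reverses
  -- in the right direction.
  have h1 := rpow_conjugate_le ht1 h (1 / 2 : ℝ)
  rw [mul_one, hone] at h1
  have h2 := rpow_le_rpow_of_nonpos (p := p - 1) ⟨by linarith [hp.1], by linarith [hp.2]⟩ h1
    (isStrictlyPositive_conjugate (isStrictlyPositive_mul_star ht) hh _)
  have h3 := star_left_conjugate_le_conjugate (rpow_conjugate_le h2 h (1 / 2 : ℝ)) t
  rw [rpow_mul_rpow_mul_rpow hh, show (1 / 2 : ℝ) + (p - 1) + 1 / 2 = p by ring] at h3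
  refine h3.trans_eq ?_
  simp only [mul_assoc]

/-- Interpolation: `star t * h ^ p * t ≤ h ^ p` for all `p ∈ [0, 1]` if it holds for
`p = 0` and `p = 1`. -/
theorem star_mul_rpow_mul_le {t h : 𝒜} (ht : IsUnit t) (ht1 : t * star t ≤ 1)
    (hh : IsStrictlyPositive h) (hth : star t * h * t ≤ h) {p : ℝ} (hp : p ∈ Set.Icc (0 : ℝ) 1) :
    star t * h ^ p * t ≤ h ^ p :=
  (hansen_rpow ht ht1 hh hp).trans (CFC.rpow_le_rpow hp hth)

/-- `x x⋆ ≤ 1` if `x⋆ x ≤ 1`. -/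
theorem mul_star_le_one {x : 𝒜} (hx : star x * x ≤ 1) : x * star x ≤ 1 := by
  rw [← CStarAlgebra.norm_le_one_iff_of_nonneg _ (mul_star_self_nonneg x),
    CStarRing.norm_self_mul_star]
  rwa [← CStarAlgebra.norm_le_one_iff_of_nonneg _ (star_mul_self_nonneg x),
    CStarRing.norm_star_mul_self] at hx

/-- `c ^ (-r) a c ^ (-r) ≤ b` iff `a ≤ c ^ r b c ^ r`. -/
theorem rpow_conjugate_le_iff {a b c : 𝒜} (hc : IsStrictlyPositive c) (r : ℝ) :
    c ^ (-r) * a * c ^ (-r) ≤ b ↔ a ≤ c ^ r * b * c ^ r := by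
  have key : ∀ (x : 𝒜) (s : ℝ), c ^ s * (c ^ (-s) * x * c ^ (-s)) * c ^ s = x := by
    intro x s
    rw [show c ^ s * (c ^ (-s) * x * c ^ (-s)) * c ^ s =
      c ^ s * c ^ (-s) * x * (c ^ (-s) * c ^ s) by simp only [mul_assoc],
      CFC.rpow_mul_rpow_neg s hc, CFC.rpow_neg_mul_rpow s hc, one_mul, mul_one]
  refine ⟨fun h => ?_, fun h => ?_⟩
  · simpa only [key] using rpow_conjugate_le h c r
  · have := rpow_conjugate_le h c (-r)
    have k := key b (-r)
    rw [neg_neg] at k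
    rwa [k] at this

/-- If `k g ^ (-α) k ≤ g ^ (2 - α)` with `α ≥ 2`, then `k g ^ u k ≤ g ^ (2 + u)` for all
`u ∈ [-α, α - 2]`. -/
theorem mul_rpow_mul_le {k g : 𝒜} (hk : IsStrictlyPositive k) (hg : IsStrictlyPositive g)
    {α : ℝ} (hα : 2 ≤ α) (h : k * g ^ (-α) * k ≤ g ^ (2 - α)) {u : ℝ} (hu : -α ≤ u)
    (hu' : u ≤ α - 2) : k * g ^ u * k ≤ g ^ (2 + u) := by
  have hks : star k = k := (IsSelfAdjoint.of_nonneg hk.nonneg).star_eq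
  -- This `t` makes the hypothesis (`u = -α`) equivalent to `t⋆ t ≤ 1`, and the other endpoint `u =
  -- α - 2` equivalent to `t t⋆ ≤ 1`. The endpoints therefore imply each other, and interpolation
  -- with `h = g^(2α-2)` covers the range between.
  set t := g ^ (-(α / 2)) * k * g ^ (-(1 - α / 2)) with ht
  have hts : star t = g ^ (-(1 - α / 2)) * k * g ^ (-(α / 2)) := by
    rw [ht, star_mul, star_mul, star_rpow, star_rpow, hks, mul_assoc]
  have htu : IsUnit t :=
    ((hg.isUnit.cfcRpow _ hg.nonneg).mul hk.isUnit).mul (hg.isUnit.cfcRpow _ hg.nonneg)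
  have e1 : ∀ c : ℝ, star t * g ^ c * t =
      g ^ (-(1 - α / 2)) * (k * g ^ (c - α) * k) * g ^ (-(1 - α / 2)) := by
    intro c
    rw [hts, ht]
    rw [show c - α = -(α / 2) + c + -(α / 2) by ring, ← rpow_mul_rpow_mul_rpow hg]
    simp only [mul_assoc]
  have e2 : t * star t = g ^ (-(α / 2)) * (k * g ^ (α - 2) * k) * g ^ (-(α / 2)) := by
    rw [hts, ht, show α - 2 = -(1 - α / 2) + -(1 - α / 2) by ring, ← rpow_mul_rpow hg]
    simp only [mul_assoc]
  have ht1 : star t * t ≤ 1 := by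
    have := e1 0
    rw [CFC.rpow_zero g hg.nonneg, mul_one, zero_sub] at this
    rw [this, rpow_conjugate_le_iff hg, mul_one, rpow_mul_rpow hg]
    convert h using 2
    ring
  have ht2 := mul_star_le_one ht1
  have ht3 : k * g ^ (α - 2) * k ≤ g ^ α := by
    have := ht2
    rw [e2, rpow_conjugate_le_iff hg, mul_one, rpow_mul_rpow hg, add_halves] at this
    exact this
  have hpos : 0 < 2 * α - 2 := by linarith
  have h4 := star_mul_rpow_mul_le htu ht2 (hg.rpow g (2 * α - 2))
    (by rw [e1, rpow_conjugate_le_iff hg, rpow_mul_rpow_mul_rpow hg]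
        convert ht3 using 3 <;> ring_nf)
    (p := (u + α) / (2 * α - 2))
    ⟨div_nonneg (by linarith) hpos.le, by rw [div_le_one hpos]; linarith⟩
  rw [rpow_rpow' hg, mul_div_cancel₀ _ hpos.ne', e1, rpow_conjugate_le_iff hg,
    rpow_mul_rpow_mul_rpow hg, add_sub_cancel_right,
    show 1 - α / 2 + (u + α) + (1 - α / 2) = 2 + u by ring] at h4
  exact h4

/-- If `k g ^ (-α) k ≤ g ^ (2 - α)` with `α ≥ 2`, then `k ^ β ≤ g ^ β` for all `β ∈ [0, α]`. -/
theorem rpow_le_rpow_of_mul_rpow_mul_le {k g : 𝒜} (hk : IsStrictlyPositive k)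
    (hg : IsStrictlyPositive g) {α : ℝ} (hα : 2 ≤ α) (h : k * g ^ (-α) * k ≤ g ^ (2 - α)) {β : ℝ}
    (hβ : 0 ≤ β) (hβα : β ≤ α) : k ^ β ≤ g ^ β := by
  have h2 : k ^ (2 : ℝ) ≤ g ^ (2 : ℝ) := by
    have := mul_rpow_mul_le hk hg hα h (u := 0) (by linarith) (by linarith)
    rw [CFC.rpow_zero g hg.nonneg, mul_one, add_zero] at this
    rwa [show (2 : ℝ) = 1 + 1 by norm_num, ← rpow_mul_rpow hk, CFC.rpow_one k hk.nonneg,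
      show (1 + 1 : ℝ) = 2 by norm_num]
  obtain ⟨n, hn⟩ := exists_nat_gt β
  induction n using Nat.strong_induction_on generalizing β with
  | _ n ih =>
    rcases le_total β 2 with hb | hb
    · have := CFC.rpow_le_rpow (p := β / 2) ⟨by linarith, by linarith⟩ h2
      rwa [rpow_rpow' hk, rpow_rpow' hg, mul_div_cancel₀ _ (two_ne_zero)] at this
    -- Steps of two: `k^β = k k^(β-2) k ≤ k g^(β-2) k ≤ g^β`.
    · have hn2 : 2 < n := by exact_mod_cast hb.trans_lt hn
      have h3 := ih (n - 2) (by omega) (β := β - 2) (by linarith) (by linarith)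
        (by rw [Nat.cast_sub hn2.le]; push_cast; linarith)
      have h4 := rpow_conjugate_le h3 k 1
      rw [rpow_mul_rpow_mul_rpow hk, CFC.rpow_one k hk.nonneg] at h4
      have h5 := h4.trans
        (mul_rpow_mul_le hk hg hα h (u := β - 2) (by linarith) (by linarith))
      convert h5 using 2 <;> ring

end CFC

/-! ### Order implications between the two unit sublevel conditions. -/

namespace Renyi

open CFC

section Order

variable {a b : 𝒜} {α z : ℝ}

/-- This is `furuta_div` for the pair in `h`: `r = z/(1-α)` and `s = z/α` turn its inner factors
into `b^(-1/2)` and `a`, and `r/(s+r) = α`. -/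
theorem mean_rpow_le_of_lt_one (ha : IsStrictlyPositive a) (hb : IsStrictlyPositive b)
    (h0 : 0 < α) (h1 : α < 1) (hz : 0 < z) (h : a ^ (α / z) ≤ b ^ ((α - 1) / z)) :
    (b ^ (-(1 / 2) : ℝ) * a * b ^ (-(1 / 2) : ℝ)) ^ α ≤ b ^ (-1 : ℝ) := by
  have h1' : 0 < 1 - α := by linarith
  have h1'' : α - 1 ≠ 0 := by linarith
  have key := furuta_div (ha.rpow a _) h (r := z / (1 - α)) (s := z / α) (by positivity)
    (by positivity)
  rw [rpow_rpow' ha, rpow_rpow' hb, rpow_rpow' hb, show α / z * (z / α) = 1 by field_simp,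
    CFC.rpow_one a ha.nonneg] at key
  have e1 : (α - 1) / z * (z / (1 - α) / 2) = -(1 / 2) := by
    field_simp; ring
  have e2 : (α - 1) / z * (z / (1 - α)) = -1 := by
    field_simp; ring
  have e3 : z / (1 - α) / (z / α + z / (1 - α)) = α := by
    field_simp; ring
  rwa [e1, e2, e3] at key

/-- As `z ≤ α - 1`, Löwner–Heinz gives `a^(α/(α-1)) ≤ b`. Inverting bounds `a^(1/2) b⁻¹ a^(1/2)` by
a power of `a`; raising to `α - 1 ≤ 1` and conjugating by `a^(1/2)` cancels that power exactly. -/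
theorem mean_rpow_le_of_le_two (ha : IsStrictlyPositive a) (hb : IsStrictlyPositive b)
    (h1 : 1 < α) (h2 : α ≤ 2) (hz : 0 < z) (hzα : z ≤ α - 1)
    (h : a ^ (α / z) ≤ b ^ ((α - 1) / z)) :
    (b ^ (-(1 / 2) : ℝ) * a * b ^ (-(1 / 2) : ℝ)) ^ α ≤ b ^ (-1 : ℝ) := by
  have h1' : 0 < α - 1 := by linarith
  have k1 := CFC.rpow_le_rpow (p := z / (α - 1))
    ⟨by positivity, by rwa [div_le_one h1']⟩ h
  rw [rpow_rpow' ha, rpow_rpow' hb, show (α - 1) / z * (z / (α - 1)) = 1 by field_simp,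
    show α / z * (z / (α - 1)) = α / (α - 1) by field_simp] at k1
  have k2 := rpow_le_rpow_of_nonpos (p := -1) (by norm_num) k1 (ha.rpow a _)
  rw [rpow_rpow' ha, rpow_rpow' hb, one_mul] at k2
  have k3 := rpow_conjugate_le k2 a (1 / 2)
  rw [rpow_mul_rpow_mul_rpow ha] at k3
  have k4 := CFC.rpow_le_rpow (p := α - 1) ⟨h1'.le, by linarith⟩ k3
  have k5 := rpow_conjugate_le k4 a (1 / 2)
  rw [rpow_rpow' ha, rpow_mul_rpow_mul_rpow ha,
    show (1 / 2 : ℝ) + (1 / 2 + α / (α - 1) * -1 + 1 / 2) * (α - 1) + 1 / 2 = 0 by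
      field_simp; ring, CFC.rpow_zero a ha.nonneg] at k5
  have k6 := rpow_conjugate_le k5 b (-(1 / 2))
  have e := conjugate_rpow ha hb 1 (-(1 / 2)) α
  rw [CFC.rpow_one a ha.nonneg, show (2 : ℝ) * -(1 / 2) = -1 by norm_num] at e
  rw [e]
  refine k6.trans_eq ?_
  rw [mul_one, rpow_mul_rpow hb]
  norm_num

/-- As `z ≤ α / 2`, Löwner–Heinz gives `a² ≤ b^(2(α-1)/α)`. For `g = b^(-1/α)` one has `k g^(-α) k =
b^(-1/2) a² b^(-1/2)`, so this is the quadratic hypothesis needed for `k^α ≤ g^α`. -/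
theorem mean_rpow_le_of_two_le (ha : IsStrictlyPositive a) (hb : IsStrictlyPositive b)
    (h2 : 2 ≤ α) (hz : 0 < z) (hzα : z ≤ α / 2) (h : a ^ (α / z) ≤ b ^ ((α - 1) / z)) :
    (b ^ (-(1 / 2) : ℝ) * a * b ^ (-(1 / 2) : ℝ)) ^ α ≤ b ^ (-1 : ℝ) := by
  have hα : 0 < α := by linarith
  have k1 := CFC.rpow_le_rpow (p := 2 * z / α)
    ⟨by positivity, by rw [div_le_one hα]; linarith⟩ h
  rw [rpow_rpow' ha, rpow_rpow' hb, show α / z * (2 * z / α) = 1 + 1 by field_simp; norm_num,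
    ← rpow_mul_rpow ha, CFC.rpow_one a ha.nonneg] at k1
  have key := rpow_le_rpow_of_mul_rpow_mul_le (g := b ^ (-(1 / α)))
    (isStrictlyPositive_conjugate ha hb (-(1 / 2))) (hb.rpow b _) h2 ?_ hα.le le_rfl
  · rwa [rpow_rpow' hb, show -(1 / α) * α = -1 by field_simp] at key
  · rw [rpow_rpow' hb, rpow_rpow' hb, show -(1 / α) * -α = 1 by field_simp]
    have e : b ^ (-(1 / 2) : ℝ) * a * b ^ (-(1 / 2) : ℝ) * b ^ (1 : ℝ) *
        (b ^ (-(1 / 2) : ℝ) * a * b ^ (-(1 / 2) : ℝ)) =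
        b ^ (-(1 / 2) : ℝ) * (a * a) * b ^ (-(1 / 2) : ℝ) := by
      have : b ^ (-(1 / 2) : ℝ) * b ^ (1 : ℝ) * b ^ (-(1 / 2) : ℝ) = 1 := by
        rw [rpow_mul_rpow_mul_rpow hb]
        norm_num [CFC.rpow_zero b hb.nonneg]
      calc _ = b ^ (-(1 / 2) : ℝ) * a * (b ^ (-(1 / 2) : ℝ) * b ^ (1 : ℝ) * b ^ (-(1 / 2) : ℝ)) *
            a * b ^ (-(1 / 2) : ℝ) := by simp only [mul_assoc]
        _ = _ := by rw [this, mul_one, mul_assoc (b ^ _) a a]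
    rw [e]
    have k2 := rpow_conjugate_le k1 b (-(1 / 2))
    rw [rpow_mul_rpow_mul_rpow hb] at k2
    convert k2 using 2
    field_simp
    ring

theorem le_rpow_of_mean_rpow_le (ha : IsStrictlyPositive a) (hb : IsStrictlyPositive b)
    (h1 : 1 < α) (hz1 : α / 2 ≤ z) (hz2 : α - 1 ≤ z)
    (h : (b ^ (-(1 / 2) : ℝ) * a * b ^ (-(1 / 2) : ℝ)) ^ α ≤ b ^ (-1 : ℝ)) :
    a ^ (α / z) ≤ b ^ ((α - 1) / z) := by
  have hα : 0 < α := by linarith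
  have hz : 0 < z := by linarith
  set k := b ^ (-(1 / 2) : ℝ) * a * b ^ (-(1 / 2) : ℝ) with hk_def
  have hk : IsStrictlyPositive k := isStrictlyPositive_conjugate ha hb _
  have hak : a = b ^ (1 / 2 : ℝ) * k * b ^ (1 / 2 : ℝ) := by
    have h3 : b ^ (1 / 2 : ℝ) * b ^ (-(1 / 2) : ℝ) = 1 := CFC.rpow_mul_rpow_neg _ hb
    have h4 : b ^ (-(1 / 2) : ℝ) * b ^ (1 / 2 : ℝ) = 1 := CFC.rpow_neg_mul_rpow _ hb
    calc a = b ^ (1 / 2 : ℝ) * b ^ (-(1 / 2) : ℝ) * a *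
          (b ^ (-(1 / 2) : ℝ) * b ^ (1 / 2 : ℝ)) := by rw [h3, h4, one_mul, mul_one]
      _ = _ := by rw [hk_def]; simp only [mul_assoc]
  have hroot : ∀ p : ℝ, 0 ≤ p → p ≤ α → k ^ p ≤ b ^ (-(p / α)) := by
    intro p hp hpα
    have := CFC.rpow_le_rpow (p := p / α) ⟨by positivity, by rwa [div_le_one hα]⟩ h
    rw [rpow_rpow' hk, rpow_rpow' hb] at this
    convert this using 2 <;> field_simp
  -- If `α ≤ z`, the bound `k ≤ b^(-1/α)` and Löwner–Heinz suffice. Otherwise `α / z ∈ [1, 2]`, and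
  -- the exchange formula is used with `b ≤ k^(-α)`; the condition `α - 1 ≤ z` keeps the remaining
  -- exponent of `k` in `[0, α]`.
  rcases le_total α z with hαz | hαz
  · have k1 := rpow_conjugate_le (hroot 1 zero_le_one h1.le) b (1 / 2)
    rw [CFC.rpow_one k hk.nonneg, ← hak, rpow_mul_rpow_mul_rpow hb] at k1
    have k2 := CFC.rpow_le_rpow (p := α / z) ⟨by positivity, by rwa [div_le_one hz]⟩ k1
    rw [rpow_rpow' hb] at k2
    convert k2 using 2
    field_simp
    ring
  · have k1 := rpow_le_rpow_of_nonpos (p := -1) (by norm_num) h (hk.rpow k _)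
    rw [rpow_rpow' hk, rpow_rpow' hb, show (-1 : ℝ) * -1 = 1 by norm_num] at k1
    have k2 := rpow_conjugate_le k1 k (1 / 2)
    rw [rpow_mul_rpow_mul_rpow hk] at k2
    have hz' : 1 ≤ α / z := by rwa [one_le_div hz]
    have hz'' : α / z ≤ 2 := by rw [div_le_iff₀ hz]; linarith
    have k3 := CFC.rpow_le_rpow (p := α / z - 1) ⟨by linarith, by linarith⟩ k2
    have k4 := rpow_conjugate_le k3 k (1 / 2)
    rw [rpow_rpow' hk, rpow_mul_rpow_mul_rpow hk] at k4
    have e4 : (1 / 2 : ℝ) + (1 / 2 + α * -1 + 1 / 2) * (α / z - 1) + 1 / 2 =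
        α * (1 - (α - 1) / z) := by field_simp; ring
    rw [e4] at k4
    have hz3 : 0 < (α - 1) / z := div_pos (by linarith) hz
    have hz4 : (α - 1) / z ≤ 1 := by rwa [div_le_one hz]
    have k5 := k4.trans (hroot _ (mul_nonneg hα.le (by linarith))
      (mul_le_of_le_one_right hα.le (by linarith)))
    have k6 := rpow_conjugate_le k5 b (1 / 2)
    have e := conjugate_rpow hk hb 1 (1 / 2) (α / z)
    rw [CFC.rpow_one k hk.nonneg, ← hak, show (2 : ℝ) * (1 / 2) = 1 by norm_num] at e
    rw [e]
    refine k6.trans_eq ?_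
    rw [rpow_mul_rpow_mul_rpow hb]
    congr 1
    field_simp
    ring

end Order

end Renyi

/-! ### Homogeneity, continuity, and the norm inequalities. -/

namespace CFC

theorem smul_rpow {a : 𝒜} (ha : IsStrictlyPositive a) {c : ℝ} (hc : 0 < c) (r : ℝ) :
    (c • a) ^ r = c ^ r • a ^ r := by
  lift c to NNReal using hc.le
  have hs : (0 : NNReal) ∉ spectrum NNReal a := spectrum.zero_notMem _ ha.isUnit
  have hc' : c ≠ 0 := by exact_mod_cast hc.ne'
  have hcont : ContinuousOn (fun x : NNReal => x ^ r) (spectrum NNReal a) :=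
    NNReal.continuousOn_rpow_const (.inl hs)
  have h1 := cfc_comp_smul c (fun x : NNReal => x ^ r) a
    (NNReal.continuousOn_rpow_const (.inl (by
      rintro ⟨x, hx, h0⟩
      rcases mul_eq_zero.1 (show c * x = 0 from h0) with h | h
      · exact hc' h
      · exact hs (h ▸ hx)))) ha.nonneg
  have h2 := cfc_smul (c ^ r) (fun x : NNReal => x ^ r) a hcont
  simp only [smul_eq_mul, NNReal.mul_rpow] at h1 h2
  have h3 : ∀ (d : NNReal) (x : 𝒜), (d : ℝ) • x = d • x := fun _ _ => rfl
  rw [← NNReal.coe_rpow, h3, h3, CFC.rpow_def, CFC.rpow_def, ← h1, h2]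

theorem isStrictlyPositive_smul {a : 𝒜} (ha : IsStrictlyPositive a) {c : ℝ} (hc : 0 < c) :
    IsStrictlyPositive (c • a) :=
  ⟨smul_nonneg hc.le ha.nonneg, ha.isUnit.smul (Units.mk0 c hc.ne')⟩

theorem continuousOn_rpow_of_pos {r : ℝ} (hr : 0 < r) :
    ContinuousOn (fun a : 𝒜 => a ^ r) {a : 𝒜 | 0 ≤ a} := by
  lift r to NNReal using hr.le
  have hr' : 0 < r := by exact_mod_cast hr
  simp_rw [← CFC.nnrpow_eq_rpow hr']
  exact CFC.continuousOn_nnrpow r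

theorem rpow_le_one_iff {a : 𝒜} (ha : 0 ≤ a) {r : ℝ} (hr : 0 < r) : a ^ r ≤ 1 ↔ a ≤ 1 := by
  rw [← CStarAlgebra.norm_le_one_iff_of_nonneg _ CFC.rpow_nonneg,
    ← CStarAlgebra.norm_le_one_iff_of_nonneg _ ha, CFC.norm_rpow a hr ha]
  simpa using Real.rpow_le_rpow_iff (norm_nonneg a) zero_le_one hr

end CFC

namespace Renyi

open CFC

/-- Norm comparison of positively homogeneous maps from comparison of their unit sublevel sets. -/
theorem norm_le_norm_of_homogeneous {f g : 𝒜 → 𝒜} {α : ℝ} (hα : 0 < α)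
    (hf : ∀ a c, IsStrictlyPositive a → 0 < c → f (c • a) = (c ^ α : ℝ) • f a)
    (hg : ∀ a c, IsStrictlyPositive a → 0 < c → g (c • a) = (c ^ α : ℝ) • g a)
    (hf0 : ∀ a, 0 ≤ a → 0 ≤ f a) (hg0 : ∀ a, IsStrictlyPositive a → IsStrictlyPositive (g a))
    (hfc : ContinuousOn f {a | 0 ≤ a}) (hgc : ContinuousOn g {a | 0 ≤ a})
    (h : ∀ a, IsStrictlyPositive a → g a ≤ 1 → f a ≤ 1) {a : 𝒜} (ha : 0 ≤ a) :
    ‖f a‖ ≤ ‖g a‖ := by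
  nontriviality 𝒜
  have key : ∀ a, IsStrictlyPositive a → ‖f a‖ ≤ ‖g a‖ := by
    intro a ha
    have hn : 0 < ‖g a‖ := norm_pos_iff.2 (hg0 a ha).isUnit.ne_zero
    -- Chosen so that `g (c • a)` has norm one.
    set c := ‖g a‖ ^ (-(1 / α)) with hc
    have hc0 : 0 < c := Real.rpow_pos_of_pos hn _
    have hcα : c ^ α = ‖g a‖⁻¹ := by
      rw [hc, ← Real.rpow_mul hn.le, show -(1 / α) * α = -1 by field_simp,
        Real.rpow_neg_one]
    have hca := isStrictlyPositive_smul ha hc0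
    have h1 := h _ hca (by
      rw [← CStarAlgebra.norm_le_one_iff_of_nonneg _ (hg0 _ hca).nonneg, hg a c ha hc0, hcα,
        norm_smul, norm_inv, norm_norm, inv_mul_cancel₀ hn.ne'])
    rw [← CStarAlgebra.norm_le_one_iff_of_nonneg _ (hf0 _ hca.nonneg), hf a c ha hc0, hcα,
      norm_smul, norm_inv, norm_norm, inv_mul_le_iff₀ hn, mul_one] at h1
    exact h1
  -- A general `a ≥ 0` is the limit of the strictly positive `a + ε • 1`.
  have ht : Filter.Tendsto (fun ε : ℝ => a + ε • (1 : 𝒜)) (nhdsWithin 0 (Set.Ioi 0))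
      (nhdsWithin a {a | 0 ≤ a}) := by
    refine tendsto_nhdsWithin_iff.2 ⟨?_, ?_⟩
    · have : Continuous fun ε : ℝ => a + ε • (1 : 𝒜) := by fun_prop
      simpa using (this.tendsto 0).mono_left nhdsWithin_le_nhds
    · filter_upwards [self_mem_nhdsWithin] with ε hε
      exact add_nonneg ha (smul_nonneg (le_of_lt hε) zero_le_one)
  refine le_of_tendsto_of_tendsto ((hfc a ha).tendsto.comp ht).norm
    ((hgc a ha).tendsto.comp ht).norm ?_
  filter_upwards [self_mem_nhdsWithin] with ε hε
  exact key _ (IsStrictlyPositive.nonneg_add ha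
    (isStrictlyPositive_smul ⟨zero_le_one, isUnit_one⟩ hε))

/-- `P_α(a, b)` in a C⋆-algebra. -/
noncomputable def cstarP (α : ℝ) (a b : 𝒜) : 𝒜 :=
  b ^ (1 / 2 : ℝ) * (b ^ (-(1 / 2) : ℝ) * a * b ^ (-(1 / 2) : ℝ)) ^ α * b ^ (1 / 2 : ℝ)

/-- `Q_{α,z}(a, b)` in a C⋆-algebra. -/
noncomputable def cstarQ (α z : ℝ) (a b : 𝒜) : 𝒜 :=
  (b ^ ((1 - α) / (2 * z)) * a ^ (α / z) * b ^ ((1 - α) / (2 * z))) ^ z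

variable {a b : 𝒜} {α z : ℝ}

theorem cstarP_nonneg : 0 ≤ cstarP α a b :=
  (IsSelfAdjoint.of_nonneg CFC.rpow_nonneg).conjugate_nonneg CFC.rpow_nonneg

theorem cstarQ_nonneg : 0 ≤ cstarQ α z a b := CFC.rpow_nonneg

theorem isStrictlyPositive_cstarP (ha : IsStrictlyPositive a) (hb : IsStrictlyPositive b) :
    IsStrictlyPositive (cstarP α a b) :=
  isStrictlyPositive_conjugate ((isStrictlyPositive_conjugate ha hb _).rpow _ _) hb _

theorem isStrictlyPositive_cstarQ (ha : IsStrictlyPositive a) (hb : IsStrictlyPositive b) :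
    IsStrictlyPositive (cstarQ α z a b) :=
  (isStrictlyPositive_conjugate (ha.rpow _ _) hb _).rpow _ _

theorem cstarP_smul (ha : IsStrictlyPositive a) (hb : IsStrictlyPositive b) {c : ℝ} (hc : 0 < c) :
    cstarP α (c • a) b = (c ^ α : ℝ) • cstarP α a b := by
  simp only [cstarP, mul_smul_comm, smul_mul_assoc]
  rw [smul_rpow (isStrictlyPositive_conjugate ha hb _) hc]
  simp only [mul_smul_comm, smul_mul_assoc]

theorem cstarQ_smul (ha : IsStrictlyPositive a) (hb : IsStrictlyPositive b) (hz : z ≠ 0) {c : ℝ}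
    (hc : 0 < c) : cstarQ α z (c • a) b = (c ^ α : ℝ) • cstarQ α z a b := by
  simp only [cstarQ]
  rw [smul_rpow ha hc]
  simp only [mul_smul_comm, smul_mul_assoc]
  rw [smul_rpow (isStrictlyPositive_conjugate (ha.rpow _ _) hb _) (Real.rpow_pos_of_pos hc _),
    ← Real.rpow_mul hc.le, div_mul_cancel₀ _ hz]

theorem continuousOn_cstarP (hα : 0 < α) : ContinuousOn (fun a => cstarP α a b) {a | 0 ≤ a} := by
  refine (continuousOn_const.mul ?_).mul continuousOn_const
  refine (continuousOn_rpow_of_pos hα).comp (by fun_prop) fun a ha => ?_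
  exact (IsSelfAdjoint.of_nonneg CFC.rpow_nonneg).conjugate_nonneg ha

theorem continuousOn_cstarQ (hα : 0 < α) (hz : 0 < z) :
    ContinuousOn (fun a => cstarQ α z a b) {a | 0 ≤ a} := by
  refine (continuousOn_rpow_of_pos hz).comp ((continuousOn_const.mul
    (continuousOn_rpow_of_pos (div_pos hα hz))).mul continuousOn_const) fun a _ => ?_
  exact (IsSelfAdjoint.of_nonneg CFC.rpow_nonneg).conjugate_nonneg CFC.rpow_nonneg

theorem cstarP_le_one_iff (hb : IsStrictlyPositive b) :
    cstarP α a b ≤ 1 ↔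
      (b ^ (-(1 / 2) : ℝ) * a * b ^ (-(1 / 2) : ℝ)) ^ α ≤ b ^ (-1 : ℝ) := by
  have h := rpow_conjugate_le_iff (a := (b ^ (-(1 / 2) : ℝ) * a * b ^ (-(1 / 2) : ℝ)) ^ α)
    (b := 1) hb (-(1 / 2))
  rw [neg_neg, mul_one, rpow_mul_rpow hb] at h
  rw [cstarP, h]
  norm_num

theorem cstarQ_le_one_iff (hb : IsStrictlyPositive b) (hz : 0 < z) :
    cstarQ α z a b ≤ 1 ↔ a ^ (α / z) ≤ b ^ ((α - 1) / z) := by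
  rw [cstarQ, rpow_le_one_iff ((IsSelfAdjoint.of_nonneg CFC.rpow_nonneg).conjugate_nonneg
    CFC.rpow_nonneg) hz, show (1 - α) / (2 * z) = -((α - 1) / z / 2) by field_simp; ring,
    rpow_conjugate_le_iff hb, mul_one, rpow_mul_rpow hb, add_halves]

theorem norm_cstarP_le_norm_cstarQ (hb : IsStrictlyPositive b) (hα : 0 < α) (hz : 0 < z)
    (h : α < 1 ∨ 1 < α ∧ z ≤ min (α / 2) (α - 1)) (ha : 0 ≤ a) :
    ‖cstarP α a b‖ ≤ ‖cstarQ α z a b‖ := by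
  refine norm_le_norm_of_homogeneous (f := fun a => cstarP α a b) (g := fun a => cstarQ α z a b)
    hα (fun a c ha hc => cstarP_smul ha hb hc) (fun a c ha hc => cstarQ_smul ha hb hz.ne' hc)
    (fun _ _ => cstarP_nonneg) (fun a ha => isStrictlyPositive_cstarQ ha hb)
    (continuousOn_cstarP hα) (continuousOn_cstarQ hα hz) (fun a ha hq => ?_) ha
  rw [cstarQ_le_one_iff hb hz] at hq
  rw [cstarP_le_one_iff hb]
  rcases h with h | ⟨h1, h⟩
  · exact mean_rpow_le_of_lt_one ha hb hα h hz hq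
  · obtain ⟨h2, h3⟩ := le_min_iff.1 h
    rcases le_total α 2 with h4 | h4
    · exact mean_rpow_le_of_le_two ha hb h1 h4 hz h3 hq
    · exact mean_rpow_le_of_two_le ha hb h4 hz h2 hq

theorem norm_cstarQ_le_norm_cstarP (hb : IsStrictlyPositive b) (h1 : 1 < α)
    (h : max (α / 2) (α - 1) ≤ z) (ha : 0 ≤ a) :
    ‖cstarQ α z a b‖ ≤ ‖cstarP α a b‖ := by
  have hα : 0 < α := by linarith
  obtain ⟨h2, h3⟩ := max_le_iff.1 h
  have hz : 0 < z := by linarith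
  refine norm_le_norm_of_homogeneous (f := fun a => cstarQ α z a b) (g := fun a => cstarP α a b)
    hα (fun a c ha hc => cstarQ_smul ha hb hz.ne' hc) (fun a c ha hc => cstarP_smul ha hb hc)
    (fun _ _ => cstarQ_nonneg) (fun a ha => isStrictlyPositive_cstarP ha hb)
    (continuousOn_cstarQ hα hz) (continuousOn_cstarP hα) (fun a ha hp => ?_) ha
  rw [cstarP_le_one_iff hb] at hp
  rw [cstarQ_le_one_iff hb hz]
  exact le_rpow_of_mean_rpow_le ha hb h1 h2 h3 hp

end Renyi

end CStar

/-! ### Compound matrices. -/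

namespace Matrix

section Compound

variable {n : ℕ} {R : Type*} [CommRing R]

/-- The `k`-th compound of a matrix: the matrix of its `k`-th exterior power, whose entries are the
`k × k` minors. -/
noncomputable def compound (k : ℕ) (A : Matrix (Fin n) (Fin n) R) :
    Matrix (Set.powersetCard (Fin n) k) (Set.powersetCard (Fin n) k) R :=
  LinearMap.toMatrix ((Pi.basisFun R (Fin n)).exteriorPower k)
    ((Pi.basisFun R (Fin n)).exteriorPower k) (exteriorPower.map k (Matrix.toLin' A))

theorem compound_mul (k : ℕ) (A B : Matrix (Fin n) (Fin n) R) :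
    compound k (A * B) = compound k A * compound k B := by
  rw [compound, Matrix.toLin'_mul, exteriorPower.map_comp,
    LinearMap.toMatrix_comp _ ((Pi.basisFun R (Fin n)).exteriorPower k)]
  rfl

theorem compound_one (k : ℕ) : compound k (1 : Matrix (Fin n) (Fin n) R) = 1 := by
  rw [compound, Matrix.toLin'_one, exteriorPower.map_id, LinearMap.toMatrix_id]

theorem compound_apply (k : ℕ) (A : Matrix (Fin n) (Fin n) R) (s t) :
    compound k A s t = (A.submatrix (Set.powersetCard.ofFinEmbEquiv.symm s)
      (Set.powersetCard.ofFinEmbEquiv.symm t)).det := by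
  rw [compound, LinearMap.toMatrix_apply, exteriorPower.basis_apply,
    exteriorPower.map_apply_ιMulti_family, exteriorPower.basis_repr_apply,
    exteriorPower.ιMulti_family, exteriorPower.ιMultiDual_apply_ιMulti, ← Matrix.det_transpose]
  congr 1
  ext i j
  simp

theorem compound_conjTranspose [StarRing R] (k : ℕ) (A : Matrix (Fin n) (Fin n) R) :
    compound k Aᴴ = (compound k A)ᴴ := by
  ext s t
  rw [conjTranspose_apply, compound_apply, compound_apply, ← det_conjTranspose]
  rfl

theorem compound_diagonal (k : ℕ) (d : Fin n → R) :
    compound k (diagonal d) =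
      diagonal fun s : Set.powersetCard (Fin n) k => ∏ i ∈ (s : Finset (Fin n)), d i := by
  ext s t
  rw [compound, LinearMap.toMatrix_apply, exteriorPower.basis_apply,
    exteriorPower.map_apply_ιMulti_family]
  have h : exteriorPower.ιMulti_family R k (⇑(toLin' (diagonal d)) ∘ ⇑(Pi.basisFun R (Fin n))) t =
      (∏ i ∈ (t : Finset (Fin n)), d i) •
        exteriorPower.ιMulti_family R k (Pi.basisFun R (Fin n)) t := by
    have h1 : ⇑(toLin' (diagonal d)) ∘ ⇑(Pi.basisFun R (Fin n)) =
        fun i => d i • Pi.basisFun R (Fin n) i := by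
      ext i j
      by_cases hij : j = i <;> simp [hij]
    rw [h1, exteriorPower.ιMulti_family, exteriorPower.ιMulti_family]
    have h2 := (exteriorPower.ιMulti R k (M := Fin n → R)).toMultilinearMap.map_smul_univ
      (d ∘ Set.powersetCard.ofFinEmbEquiv.symm t)
      (Pi.basisFun R (Fin n) ∘ Set.powersetCard.ofFinEmbEquiv.symm t)
    have h3 : ∏ i, (d ∘ Set.powersetCard.ofFinEmbEquiv.symm t) i =
        ∏ i ∈ (t : Finset (Fin n)), d i := by
      have : (t : Finset (Fin n)) =
          Finset.univ.map (Set.powersetCard.ofFinEmbEquiv.symm t).toEmbedding := by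
        ext i
        rw [Set.powersetCard.mem_coe_iff,
          ← Set.powersetCard.mem_range_ofFinEmbEquiv_symm_iff_mem]
        simp
      rw [this, Finset.prod_map]
      rfl
    rw [h3] at h2
    exact h2
  rw [h, map_smul, Finsupp.smul_apply, exteriorPower.basis_repr, Matrix.diagonal_apply,
    Finsupp.single_apply]
  by_cases hst : s = t
  · simp [hst]
  · simp [hst, Ne.symm hst]

end Compound

/-! ### Real powers, determinants and compounds through diagonalization. -/

section Spectral

open scoped MatrixOrder

variable {ι : Type*} [Fintype ι] [DecidableEq ι]

/-- The functional calculus of a unitarily diagonalized matrix. -/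
theorem cfc_unitary_diagonal {V : Matrix ι ι ℂ} (hV : V ∈ unitary (Matrix ι ι ℂ)) (d : ι → ℝ)
    (f : ℝ → ℝ) : cfc f (V * diagonal (fun i => (d i : ℂ)) * star V) =
      V * diagonal (fun i => (f (d i) : ℂ)) * star V := by
  have hM : (V * diagonal (fun i => (d i : ℂ)) * star V).IsHermitian := by
    refine isHermitian_mul_mul_conjTranspose V ?_
    rw [isHermitian_diagonal_iff]
    intro i
    simp [isSelfAdjoint_iff]
  set M := V * diagonal (fun i => (d i : ℂ)) * star V with hMdef
  rw [hM.cfc_eq, IsHermitian.cfc, Unitary.conjStarAlgAut_apply]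
  have hspec := hM.spectral_theorem
  rw [Unitary.conjStarAlgAut_apply] at hspec
  set W : Matrix ι ι ℂ := (hM.eigenvectorUnitary : Matrix ι ι ℂ) with hW
  have hV1 : star V * V = 1 := (Unitary.mem_iff.1 hV).1
  have hV2 : V * star V = 1 := (Unitary.mem_iff.1 hV).2
  have hW1 : star W * W = 1 := Unitary.coe_star_mul_self hM.eigenvectorUnitary
  have hW2 : W * star W = 1 := Unitary.coe_mul_star_self hM.eigenvectorUnitary
  have h1 : star W * V * diagonal (fun i => (d i : ℂ)) =
      diagonal (RCLike.ofReal ∘ hM.eigenvalues) * (star W * V) := by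
    calc star W * V * diagonal (fun i => (d i : ℂ))
        = star W * (V * diagonal (fun i => (d i : ℂ)) * star V) * V := by
          simp only [mul_assoc, hV1, mul_one]
      _ = star W * (W * diagonal (RCLike.ofReal ∘ hM.eigenvalues) * star W) * V := by
          rw [← hMdef, ← hspec]
      _ = _ := by simp only [← mul_assoc, hW1, one_mul]
  -- `W⋆ V` intertwines the two diagonal matrices, so a nonzero `(i, j)` entry forces `d j` to equal
  -- the `i`-th eigenvalue; hence it also intertwines their images under `f`.
  have h2 : star W * V * diagonal (fun i => (f (d i) : ℂ)) =
      diagonal (RCLike.ofReal ∘ f ∘ hM.eigenvalues) * (star W * V) := by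
    ext i j
    have h3 := congrFun (congrFun h1 i) j
    rw [mul_diagonal, diagonal_mul] at h3 ⊢
    rcases eq_or_ne ((star W * V) i j) 0 with h0 | h0
    · simp [h0]
    · rw [mul_comm] at h3
      have h4 := mul_right_cancel₀ h0 h3
      have h5 : d j = hM.eigenvalues i := Complex.ofReal_injective h4
      rw [mul_comm, h5]
      rfl
  calc W * diagonal (RCLike.ofReal ∘ f ∘ hM.eigenvalues) * star W
      = W * (diagonal (RCLike.ofReal ∘ f ∘ hM.eigenvalues) * (star W * V)) * star V := by
        simp only [mul_assoc, hV2, mul_one]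
    _ = W * (star W * V * diagonal (fun i => (f (d i) : ℂ))) * star V := by rw [h2]
    _ = _ := by simp only [← mul_assoc, hW2, one_mul]

theorem posSemidef_unitary_diagonal (V : Matrix ι ι ℂ) {d : ι → ℝ} (hd : ∀ i, 0 ≤ d i) :
    (V * diagonal (fun i => (d i : ℂ)) * star V).PosSemidef :=
  (PosSemidef.diagonal (fun i => Complex.zero_le_real.2 (hd i))).mul_mul_conjTranspose_same V

theorem rpow_unitary_diagonal {V : Matrix ι ι ℂ} (hV : V ∈ unitary (Matrix ι ι ℂ)) {d : ι → ℝ}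
    (hd : ∀ i, 0 ≤ d i) (r : ℝ) : (V * diagonal (fun i => (d i : ℂ)) * star V) ^ r =
      V * diagonal (fun i => ((d i ^ r : ℝ) : ℂ)) * star V := by
  rw [CFC.rpow_eq_cfc_real (posSemidef_unitary_diagonal V hd).nonneg,
    cfc_unitary_diagonal hV d fun x => x ^ r]

theorem PosSemidef.eq_unitary_diagonal {A : Matrix ι ι ℂ} (hA : A.PosSemidef) :
    A = (hA.isHermitian.eigenvectorUnitary : Matrix ι ι ℂ) *
      diagonal (fun i => (hA.isHermitian.eigenvalues i : ℂ)) *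
      star (hA.isHermitian.eigenvectorUnitary : Matrix ι ι ℂ) := by
  have h := hA.isHermitian.spectral_theorem
  rwa [Unitary.conjStarAlgAut_apply] at h

/-- `det (A ^ r) = (det A) ^ r`. -/
theorem PosSemidef.det_rpow {A : Matrix ι ι ℂ} (hA : A.PosSemidef) {δ : ℝ} (hδ : A.det = δ)
    (r : ℝ) : (A ^ r).det = ((δ ^ r : ℝ) : ℂ) := by
  have h := hA.eq_unitary_diagonal
  set U := hA.isHermitian.eigenvectorUnitary
  set e := hA.isHermitian.eigenvalues
  have hU : (U : Matrix ι ι ℂ).det * (star (U : Matrix ι ι ℂ)).det = 1 := by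
    rw [← det_mul, (Unitary.mem_iff.1 U.2).2, det_one]
  have hdet : ∀ d : ι → ℂ, ((U : Matrix ι ι ℂ) * diagonal d * star (U : Matrix ι ι ℂ)).det =
      ∏ i, d i := by
    intro d
    rw [det_mul, det_mul, det_diagonal, mul_right_comm, hU, one_mul]
  have hδ' : δ = ∏ i, e i := by
    rw [h, hdet] at hδ
    exact_mod_cast hδ.symm
  rw [h, rpow_unitary_diagonal U.2 hA.eigenvalues_nonneg, hdet, hδ',
    ← Real.finsetProd_rpow _ _ fun i _ => hA.eigenvalues_nonneg i]
  push_cast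
  rfl

end Spectral

section CompoundSpectral

open scoped MatrixOrder

variable {n : ℕ} (k : ℕ) {A : Matrix (Fin n) (Fin n) ℂ}

theorem compound_mem_unitary {V : Matrix (Fin n) (Fin n) ℂ}
    (hV : V ∈ unitary (Matrix (Fin n) (Fin n) ℂ)) : compound k V ∈ unitary _ := by
  rw [Unitary.mem_iff] at hV ⊢
  simp only [star_eq_conjTranspose] at hV ⊢
  rw [← compound_conjTranspose, ← compound_mul, ← compound_mul, hV.1, hV.2, compound_one]
  exact ⟨rfl, rfl⟩

theorem compound_unitary_diagonal (V : Matrix (Fin n) (Fin n) ℂ) (d : Fin n → ℝ) :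
    compound k (V * diagonal (fun i => (d i : ℂ)) * star V) =
      compound k V * diagonal (fun s : Set.powersetCard (Fin n) k =>
        ((∏ i ∈ (s : Finset (Fin n)), d i : ℝ) : ℂ)) *
        star (compound k V) := by
  rw [compound_mul, compound_mul, compound_diagonal, star_eq_conjTranspose, star_eq_conjTranspose,
    compound_conjTranspose]
  push_cast
  rfl

theorem PosSemidef.compound (hA : A.PosSemidef) : (compound k A).PosSemidef := by
  rw [hA.eq_unitary_diagonal, compound_unitary_diagonal]
  exact posSemidef_unitary_diagonal _ fun s =>
    Finset.prod_nonneg fun i _ => hA.eigenvalues_nonneg i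

theorem PosDef.compound (hA : A.PosDef) : (compound k A).PosDef := by
  rw [← isStrictlyPositive_iff_posDef]
  refine ⟨(hA.posSemidef.compound k).nonneg, ?_⟩
  obtain ⟨u, hu⟩ := hA.isUnit
  refine IsUnit.of_mul_eq_one (Matrix.compound k (↑u⁻¹ : Matrix (Fin n) (Fin n) ℂ)) ?_
  rw [← hu, ← compound_mul, u.mul_inv, compound_one]

/-- In a common diagonalization this is multiplicativity of `x ↦ x^r` on products of nonnegative
eigenvalues. -/
theorem PosSemidef.compound_rpow (hA : A.PosSemidef) (r : ℝ) :
    Matrix.compound k (A ^ r) = Matrix.compound k A ^ r := by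
  have h := hA.eq_unitary_diagonal
  set U := hA.isHermitian.eigenvectorUnitary
  rw [h, rpow_unitary_diagonal U.2 hA.eigenvalues_nonneg, compound_unitary_diagonal,
    compound_unitary_diagonal, rpow_unitary_diagonal (compound_mem_unitary k U.2)
      fun s => Finset.prod_nonneg fun i _ => hA.eigenvalues_nonneg i]
  congr! 4 with s
  rw [← Real.finsetProd_rpow _ _ fun i _ => hA.eigenvalues_nonneg i]

end CompoundSpectral

end Matrix

/-! ### Products of the largest terms of a decreasing sequence. -/

section Majorization

/-- A strictly increasing map `Fin k → Fin m` dominates the inclusion. -/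
theorem Fin.val_le_of_strictMono {k m : ℕ} {f : Fin k → Fin m} (hf : StrictMono f) (j : Fin k) :
    (j : ℕ) ≤ f j := by
  obtain ⟨j, hj⟩ := j
  induction j with
  | zero => exact Nat.zero_le _
  | succ j ih =>
    have h1 := ih (by omega)
    have h2 : f ⟨j, by omega⟩ < f ⟨j + 1, hj⟩ := hf (by simp [Fin.lt_def])
    rw [Fin.lt_def] at h2
    simp only at h1 ⊢
    omega

theorem Fin.prod_val_lt_eq {k m : ℕ} (hkm : k ≤ m) (f : Fin m → ℝ) :
    ∏ i : Fin m with i.val < k, f i = ∏ j : Fin k, f (Fin.castLE hkm j) := by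
  have : (Finset.univ.filter fun i : Fin m => i.val < k) =
      Finset.univ.map (Fin.castLEEmb hkm) := by
    ext i
    simp only [Finset.mem_filter, Finset.mem_univ, true_and, Finset.mem_map]
    exact ⟨fun h => ⟨⟨i, h⟩, rfl⟩, by rintro ⟨j, rfl⟩; exact j.2⟩
  rw [this, Finset.prod_map]
  rfl

/-- Among the products of `k` terms of a nonnegative decreasing sequence, that of the first `k`
terms is the largest. -/
theorem Antitone.prod_le_prod_val_lt {k m : ℕ} {f : Fin m → ℝ} (hf : Antitone f)
    (hf0 : ∀ i, 0 ≤ f i) {s : Finset (Fin m)} (hs : s.card = k) :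
    ∏ i ∈ s, f i ≤ ∏ i : Fin m with i.val < k, f i := by
  have hkm : k ≤ m := by simpa [hs] using s.card_le_univ
  have : s = Finset.univ.map (s.orderEmbOfFin hs).toEmbedding := by
    ext i
    rw [← Finset.mem_coe, ← Finset.range_orderEmbOfFin s hs]
    simp
  rw [Fin.prod_val_lt_eq hkm, this, Finset.prod_map]
  refine Finset.prod_le_prod (fun _ _ => hf0 _) fun j _ => hf ?_
  exact Fin.val_le_of_strictMono (s.orderEmbOfFin hs).strictMono j

end Majorization

/-! ### Norms of compounds and sorted eigenvalues. -/

namespace Matrix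

open scoped MatrixOrder Matrix.Norms.L2Operator

variable {n : ℕ} {A : Matrix (Fin n) (Fin n) ℂ}

theorem norm_unitary_diagonal {ι : Type*} [Fintype ι] [DecidableEq ι] {V : Matrix ι ι ℂ}
    (hV : V ∈ unitary (Matrix ι ι ℂ)) (d : ι → ℂ) : ‖V * diagonal d * star V‖ = ‖d‖ := by
  rw [CStarRing.norm_mul_mem_unitary _ (Unitary.star_mem hV),
    CStarRing.norm_mem_unitary_mul _ hV, l2_opNorm_diagonal]

theorem PosSemidef.eigenvalues₀_nonneg {ι : Type*} [Fintype ι] [DecidableEq ι] {A : Matrix ι ι ℂ}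
    (hA : A.PosSemidef) (i) : 0 ≤ hA.isHermitian.eigenvalues₀ i := by
  have h := hA.eigenvalues_nonneg (Fintype.equivOfCardEq (Fintype.card_fin _) i)
  rwa [IsHermitian.eigenvalues, Equiv.symm_apply_apply] at h

/-- The norm of the `k`-th compound is the product of the `k` largest eigenvalues. -/
theorem PosSemidef.norm_compound (hA : A.PosSemidef) {k : ℕ} (hk : k ≤ Fintype.card (Fin n)) :
    ‖Matrix.compound k A‖ = ∏ i : Fin (Fintype.card (Fin n)) with i.val < k,
      hA.isHermitian.eigenvalues₀ i := by
  conv_lhs => rw [hA.eq_unitary_diagonal, compound_unitary_diagonal]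
  rw [norm_unitary_diagonal (compound_mem_unitary k (SetLike.coe_mem _))]
  set σ : Fin n ≃ Fin (Fintype.card (Fin n)) :=
    (Fintype.equivOfCardEq (Fintype.card_fin _)).symm with hσ
  have hprod : ∀ s : Finset (Fin n), ∏ i ∈ s, hA.isHermitian.eigenvalues i =
      ∏ i ∈ s.map σ.toEmbedding, hA.isHermitian.eigenvalues₀ i := by
    intro s
    rw [Finset.prod_map]
    rfl
  have h0 : 0 ≤ ∏ i : Fin (Fintype.card (Fin n)) with i.val < k,
      hA.isHermitian.eigenvalues₀ i := Finset.prod_nonneg fun i _ => hA.eigenvalues₀_nonneg i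
  have hnorm : ∀ s : Set.powersetCard (Fin n) k,
      ‖((∏ i ∈ (s : Finset (Fin n)), hA.isHermitian.eigenvalues i : ℝ) : ℂ)‖ =
        ∏ i ∈ (s : Finset (Fin n)), hA.isHermitian.eigenvalues i := fun s => by
    rw [Complex.norm_real, Real.norm_of_nonneg
      (Finset.prod_nonneg fun i _ => hA.eigenvalues_nonneg i)]
  apply le_antisymm
  · refine (pi_norm_le_iff_of_nonneg h0).2 fun s => ?_
    rw [hnorm, hprod]
    exact hA.isHermitian.eigenvalues₀_antitone.prod_le_prod_val_lt hA.eigenvalues₀_nonneg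
      (by rw [Finset.card_map]; exact s.2)
  -- The sup norm of the diagonal is attained at the subset pulled back from the first `k` sorted
  -- positions.
  · set t : Finset (Fin (Fintype.card (Fin n))) := Finset.univ.filter fun i => i.val < k with ht
    have hcard : (t.map σ.symm.toEmbedding).card = k := by
      rw [Finset.card_map, ht, Fin.card_filter_val_lt, min_eq_right hk]
    refine le_trans (le_of_eq ?_) (norm_le_pi_norm _ (Set.powersetCard.ofCard hcard))
    rw [hnorm, hprod]
    congr 1
    change t = (t.map σ.symm.toEmbedding).map σ.toEmbedding
    rw [Finset.map_map]
    ext i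
    simp

theorem IsHermitian.prod_eigenvalues₀ {ι : Type*} [Fintype ι] [DecidableEq ι] {A : Matrix ι ι ℂ}
    (hA : A.IsHermitian) : ((∏ i, hA.eigenvalues₀ i : ℝ) : ℂ) = A.det := by
  rw [hA.det_eq_prod_eigenvalues]
  push_cast
  exact (Equiv.prod_comp (Fintype.equivOfCardEq (Fintype.card_fin _)).symm
    fun i => (hA.eigenvalues₀ i : ℂ)).symm

end Matrix

/-! ### Log-majorization from the norm inequalities. -/

namespace Renyi

open scoped MatrixOrder Matrix.Norms.L2Operator

variable {n : ℕ} {A B : Matrix (Fin n) (Fin n) ℂ} {α z : ℝ}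

theorem posSemidef_rpow {ι : Type*} [Fintype ι] [DecidableEq ι] (A : Matrix ι ι ℂ) (r : ℝ) :
    (A ^ r).PosSemidef :=
  Matrix.nonneg_iff_posSemidef.1 CFC.rpow_nonneg

theorem posSemidef_rpow_conjugate {ι : Type*} [Fintype ι] [DecidableEq ι] {A : Matrix ι ι ℂ}
    (hA : A.PosSemidef) (B : Matrix ι ι ℂ) (r : ℝ) : (B ^ r * A * B ^ r).PosSemidef :=
  Matrix.nonneg_iff_posSemidef.1
    ((IsSelfAdjoint.of_nonneg CFC.rpow_nonneg).conjugate_nonneg hA.nonneg)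

theorem posSemidef_P : (P α A B).PosSemidef := posSemidef_rpow_conjugate (posSemidef_rpow _ _) _ _

theorem posSemidef_Q : (Q α z A B).PosSemidef := posSemidef_rpow _ _

theorem compound_P (k : ℕ) (hA : A.PosSemidef) (hB : B.PosSemidef) :
    Matrix.compound k (P α A B) = cstarP α (Matrix.compound k A) (Matrix.compound k B) := by
  simp only [P, cstarP, Matrix.compound_mul,
    (posSemidef_rpow_conjugate hA B (-(1 / 2))).compound_rpow, hB.compound_rpow]

theorem compound_Q (k : ℕ) (hA : A.PosSemidef) (hB : B.PosSemidef) :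
    Matrix.compound k (Q α z A B) = cstarQ α z (Matrix.compound k A) (Matrix.compound k B) := by
  simp only [Q, cstarQ, Matrix.compound_mul, hA.compound_rpow, hB.compound_rpow,
    (posSemidef_rpow_conjugate (posSemidef_rpow A (α / z)) B _).compound_rpow]

/-- Both determinants equal `(det A)^α (det B)^(1-α)`. Since `det A` may vanish, only powers of `det
B` are combined by adding exponents. -/
theorem det_P_eq_det_Q (hA : A.PosSemidef) (hB : B.PosDef) (hz : 0 < z) :
    (P α A B).det = (Q α z A B).det := by
  obtain ⟨a, ha0, ha⟩ : ∃ a : ℝ, 0 ≤ a ∧ A.det = a :=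
    ⟨_, Finset.prod_nonneg fun i _ => hA.eigenvalues₀_nonneg i,
      hA.isHermitian.prod_eigenvalues₀.symm⟩
  obtain ⟨b, hb0, hb⟩ : ∃ b : ℝ, 0 < b ∧ B.det = b := by
    refine ⟨_, ?_, hB.isHermitian.prod_eigenvalues₀.symm⟩
    have := hB.det_pos
    rw [← hB.isHermitian.prod_eigenvalues₀] at this
    exact_mod_cast this
  have hr : ∀ r : ℝ, (B ^ r).det = ((b ^ r : ℝ) : ℂ) := hB.posSemidef.det_rpow hb
  have hK : (B ^ (-(1 / 2) : ℝ) * A * B ^ (-(1 / 2) : ℝ)).det =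
      ((b ^ (-(1 / 2) : ℝ) * a * b ^ (-(1 / 2) : ℝ) : ℝ) : ℂ) := by
    rw [Matrix.det_mul, Matrix.det_mul, hr, ha]
    push_cast
    rfl
  have hL : (B ^ ((1 - α) / (2 * z)) * A ^ (α / z) * B ^ ((1 - α) / (2 * z))).det =
      ((b ^ ((1 - α) / (2 * z)) * a ^ (α / z) * b ^ ((1 - α) / (2 * z)) : ℝ) : ℂ) := by
    rw [Matrix.det_mul, Matrix.det_mul, hr, hA.det_rpow ha]
    push_cast
    rfl
  rw [P, Q, Matrix.det_mul, Matrix.det_mul, hr,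
    (posSemidef_rpow_conjugate hA B _).det_rpow hK,
    (posSemidef_rpow_conjugate (posSemidef_rpow A _) B _).det_rpow hL]
  norm_cast
  have hbr : ∀ r : ℝ, 0 ≤ b ^ r := fun r => (Real.rpow_pos_of_pos hb0 r).le
  have har : ∀ r : ℝ, 0 ≤ a ^ r := fun r => Real.rpow_nonneg ha0 r
  rw [Real.mul_rpow (mul_nonneg (hbr _) ha0) (hbr _), Real.mul_rpow (hbr _) ha0,
    Real.mul_rpow (mul_nonneg (hbr _) (har _)) (hbr _), Real.mul_rpow (hbr _) (har _)]
  simp only [← Real.rpow_mul hb0.le, ← Real.rpow_mul ha0]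
  rw [div_mul_cancel₀ α hz.ne']
  calc b ^ (1 / 2 : ℝ) * (b ^ (-(1 / 2) * α) * a ^ α * b ^ (-(1 / 2) * α)) * b ^ (1 / 2 : ℝ)
      = a ^ α * (b ^ (1 / 2 : ℝ) * b ^ (-(1 / 2) * α) * (b ^ (-(1 / 2) * α) * b ^ (1 / 2 : ℝ))) := by
        ring
    _ = a ^ α * (b ^ ((1 - α) / (2 * z) * z) * b ^ ((1 - α) / (2 * z) * z)) := by
        simp only [← Real.rpow_add hb0]
        congr 2
        field_simp
        ring
    _ = _ := by ring

theorem logMajorizedBy_of_norm_compound_le {X Y : Matrix (Fin n) (Fin n) ℂ} (hX : X.PosSemidef)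
    (hY : Y.PosSemidef) (h : ∀ k, ‖Matrix.compound k X‖ ≤ ‖Matrix.compound k Y‖)
    (hdet : X.det = Y.det) : LogMajorizedBy X Y := by
  refine ⟨hX, hY, fun k _ hk => ?_, ?_⟩
  · rw [← hX.norm_compound hk, ← hY.norm_compound hk]
    exact h k
  · rw [← hX.isHermitian.prod_eigenvalues₀, ← hY.isHermitian.prod_eigenvalues₀] at hdet
    exact_mod_cast hdet

theorem P_logMajorizedBy_Q (hA : A.PosSemidef) (hB : B.PosDef) (hα : 0 < α) (hz : 0 < z)
    (h : α < 1 ∨ 1 < α ∧ z ≤ min (α / 2) (α - 1)) : LogMajorizedBy (P α A B) (Q α z A B) := by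
  refine logMajorizedBy_of_norm_compound_le posSemidef_P posSemidef_Q (fun k => ?_)
    (det_P_eq_det_Q hA hB hz)
  rw [compound_P k hA hB.posSemidef, compound_Q k hA hB.posSemidef]
  exact norm_cstarP_le_norm_cstarQ (hB.compound k).isStrictlyPositive hα hz h
    (hA.compound k).nonneg

theorem Q_logMajorizedBy_P (hA : A.PosSemidef) (hB : B.PosDef) (hα : 1 < α)
    (h : max (α / 2) (α - 1) ≤ z) : LogMajorizedBy (Q α z A B) (P α A B) := by
  have hz : 0 < z := by linarith [(max_le_iff.1 h).1]
  refine logMajorizedBy_of_norm_compound_le posSemidef_Q posSemidef_P (fun k => ?_)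
    (det_P_eq_det_Q hA hB hz).symm
  rw [compound_P k hA hB.posSemidef, compound_Q k hA hB.posSemidef]
  exact norm_cstarQ_le_norm_cstarP (hB.compound k).isStrictlyPositive hα h (hA.compound k).nonneg

end Renyi

theorem theorem1p1 (n : ℕ) (A B : Matrix (Fin n) (Fin n) ℂ)
    (hA : A.PosSemidef) (hB : B.PosDef) :
    (∀ α z : ℝ, 0 < α → α < 1 → 0 < z →
      Renyi.LogMajorizedBy (Renyi.P α A B) (Renyi.Q α z A B)) ∧
    (∀ α z : ℝ, 1 < α → 0 < z → z ≤ min (α / 2) (α - 1) →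
      Renyi.LogMajorizedBy (Renyi.P α A B) (Renyi.Q α z A B)) ∧
    (∀ α z : ℝ, 1 < α → max (α / 2) (α - 1) ≤ z →
      Renyi.LogMajorizedBy (Renyi.Q α z A B) (Renyi.P α A B)) ∧
    (∀ α : ℝ, (0 < α ∧ α < 1) ∨ 2 ≤ α →
      Renyi.LogMajorizedBy (Renyi.P α A B) (Renyi.Q₁ α A B)) ∧
    (∀ α : ℝ, 1 < α → α ≤ 2 →
      Renyi.LogMajorizedBy (Renyi.Q₁ α A B) (Renyi.P α A B)) := by
  refine ⟨fun α z h0 h1 hz => Renyi.P_logMajorizedBy_Q hA hB h0 hz (.inl h1),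
    fun α z h1 hz h => Renyi.P_logMajorizedBy_Q hA hB (by linarith) hz (.inr ⟨h1, h⟩),
    fun α z h1 h => Renyi.Q_logMajorizedBy_P hA hB h1 h, fun α h => ?_, fun α h1 h2 => ?_⟩
  -- At `z = 1`, the condition `1 ≤ min (α/2) (α-1)` means `α ≥ 2`, and `max (α/2) (α-1) ≤ 1` means
  -- `α ≤ 2`.
  · rcases h with ⟨h0, h1⟩ | h2
    · exact Renyi.P_logMajorizedBy_Q hA hB h0 one_pos (.inl h1)
    · exact Renyi.P_logMajorizedBy_Q hA hB (by linarith) one_pos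
        (.inr ⟨by linarith, le_min (by linarith) (by linarith)⟩)
  · exact Renyi.Q_logMajorizedBy_P hA hB h1 (max_le (by linarith) (by linarith))
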